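/- Setting. Let $B,K\ge 1$ and $N$ be integers, $F=GF(2^B)$, $M=2^{BK}$. A message in $F^K$ is sent with one of the $M$ symbols $s_m=\sqrt{\rho}\,x_m$, where $x_1,\dots,x_M\in\mathbb{C}$ are fixed distinct points (not depending on $\rho$) with $\frac1M\sum_m x_m=0$ and $\frac1M\sum_m|x_m|^2=1$, all symbols are equally likely, and the symbols are labelled bijectively by the messages $\mathbf a(s_m)\in F^K$. Let $G\in F^{K\times N}$, let $\mathbf c(s)=\mathbf a(s)G\in F^N$ be the codeword of $s$, $\mathcal C=\{\mathbf c(s_1),\dots,\mathbf c(s_M)\}$, and $d_{\min}(\mathcal C)=\min_{s\neq s'}d_H(\mathbf c(s),\mathbf c(s'))$, where $d_H$ is the Hamming distance and the minimum is over pairs of distinct symbols. Node $i\in\{1,\dots,N\}$ receives $y_i=h_is+n_i$, where the $h_i$ and $n_i$ are all independent with law $\mathcal{CN}(0,1)$ (i.i.d. Rayleigh fading) and independent of $s$. Knowing $h_i$, it makes a minimum distance hard decision on the transmitted symbol (a minimizer over $s'$ of $|y_i-h_is'|$, with ties broken arbitrarily but measurably) and forwards $u_i=\widehat{\mathbf a}_i\,\mathbf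 g_i^{T}\in F$ without error, where $\widehat{\mathbf a}_i$ is the message it detected and $\mathbf g_i^{T}$ is the $i$-th column of $G$. The fusion center knows $\mathbf h=(h_1,\dots,h_N)$ and $\mathbf u=(u_1,\dots,u_N)$ and outputs a maximum likelihood decision, i.e. a maximizer over $s$ of $\Pr(\mathbf u\mid s,\mathbf h)$, with ties broken arbitrarily. Let $P_e(\mathbf h,\rho)$ be the symbol error probability at the fusion center given $\mathbf h$, and $P_e(\rho)=E[P_e(\mathbf h,\rho)]$ its expectation over $\mathbf h$. Lemma 1. The system has diversity order exactly $d_{\min}(\mathcal C)$: for every $\rho>0$ the function $\mathbf h\mapsto P_e(\mathbf h,\rho)$ is integrable, $P_e(\rho)>0$ for all sufficiently large $\rho$, and $$-\lim_{\rho\to\infty}\frac{\log P_e(\rho)}{\log\rho}=d_{\min}(\mathcal C).$$ -/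

import Mathlib

open scoped Matrix
open MeasureTheory Filter Topology

noncomputable section

namespace CodedDiversity

/-- The circularly symmetric complex Gaussian law `CN(0,1)`, with density `π⁻¹ exp(-|z|²)`.
If `h` has this law then `|h|` is Rayleigh distributed with `E|h|² = 1`. -/
def stdCN : Measure ℂ :=
  volume.withDensity fun z => ENNReal.ofReal (Real.pi⁻¹ * Real.exp (-‖z‖ ^ 2))

instance : IsProbabilityMeasure stdCN := by
  have hI : ∫ z : ℂ, Real.exp (-‖z‖ ^ 2) = Real.pi := by
    have h := Complex.integral_exp_neg_rpow (p := 2) (by norm_num)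
    norm_num at h
    simpa using h
  have hint : Integrable (fun z : ℂ => Real.exp (-‖z‖ ^ 2)) := by
    by_contra hc
    rw [integral_undef hc] at hI
    exact Real.pi_ne_zero hI.symm
  refine ⟨?_⟩
  rw [stdCN, withDensity_apply _ MeasurableSet.univ, Measure.restrict_univ,
    ← ofReal_integral_eq_lintegral_ofReal (hint.const_mul _)
      (Filter.Eventually.of_forall fun z => by positivity),
    integral_const_mul, hI, inv_mul_cancel₀ Real.pi_ne_zero, ENNReal.ofReal_one]

/-- The law of a vector of `N` i.i.d. `CN(0,1)` entries: the law of the channel vector `h`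
(spatially uncorrelated Rayleigh fading) and also the law of the noise vector `n`. -/
def stdCNVec (N : ℕ) : Measure (Fin N → ℂ) :=
  Measure.pi fun _ => stdCN

/-- An `M`-point constellation normalized to zero mean and unit average energy (under the uniform
distribution on the points). -/
structure Constellation (M : ℕ) where
  point : Fin M → ℂ
  injective : Function.Injective point
  mean_zero : (1 / (M : ℂ)) * ∑ m, point m = 0
  unit_energy : (1 / (M : ℝ)) * ∑ m, ‖point m‖ ^ 2 = 1

/-- The symbol transmitted for index `m` at SNR `ρ`; the average energy of these symbols is `ρ`. -/
def Constellation.symbol {M : ℕ} (S : Constellation M) (ρ : ℝ) (m : Fin M) : ℂ :=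
  (Real.sqrt ρ : ℂ) * S.point m

variable {F : Type*} [Field F] {N K M : ℕ}

/-- The codeword `c(s_m) = a G`, where `a = label m` is the message vector of `s_m`. -/
def codeword (label : Fin M ≃ (Fin K → F)) (G : Matrix (Fin K) (Fin N) F) (m : Fin M) :
    Fin N → F :=
  label m ᵥ* G

/-- The minimum Hamming distance `min_{s ≠ s'} d_H(c(s), c(s'))` of the codeword set. -/
def dmin [DecidableEq F] (label : Fin M ≃ (Fin K → F)) (G : Matrix (Fin K) (Fin N) F) : ℕ :=
  sInf {d | ∃ m m' : Fin M, m ≠ m' ∧ d = hammingDist (codeword label G m) (codeword label G m')}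

/-- `det ρ i h y` is the hard decision of node `i` from its received value `y` and its own channel
coefficient `h`.  It is a minimum distance decision: it minimizes `|y - h s'|` over the
constellation (for `h ≠ 0` this is the same as minimizing `|y / h - s'|`).  Ties are broken
arbitrarily, but measurably. -/
structure IsHardDecision (S : Constellation M) (det : ℝ → Fin N → ℂ → ℂ → Fin M) : Prop where
  measurable : ∀ ρ i, Measurable fun p : ℂ × ℂ => det ρ i p.1 p.2
  min_dist : ∀ ρ, 0 < ρ → ∀ i h y m',
    ‖y - h * S.symbol ρ (det ρ i h y)‖ ≤ ‖y - h * S.symbol ρ m'‖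

/-- The vector `u` received by the fusion center when `s_m` is sent, the channel vector is `h` and
the noise vector is `n`.  Node `i` observes `h_i s_m + n_i`, makes its hard decision, and forwards
the product of the message vector it detected with column `i` of `G`. -/
def nodeOutput (S : Constellation M) (label : Fin M ≃ (Fin K → F)) (G : Matrix (Fin K) (Fin N) F)
    (det : ℝ → Fin N → ℂ → ℂ → Fin M) (ρ : ℝ) (h : Fin N → ℂ) (m : Fin M) (n : Fin N → ℂ) :
    Fin N → F :=
  fun i => label (det ρ i (h i) (h i * S.symbol ρ m + n i)) ⬝ᵥ fun k => G k i

/-- The likelihood `Pr(u_1, …, u_N | s_m, h)`. -/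
def likelihood (S : Constellation M) (label : Fin M ≃ (Fin K → F))
    (G : Matrix (Fin K) (Fin N) F) (det : ℝ → Fin N → ℂ → ℂ → Fin M)
    (ρ : ℝ) (h : Fin N → ℂ) (u : Fin N → F) (m : Fin M) : ℝ :=
  (stdCNVec N).real {n | nodeOutput S label G det ρ h m n = u}

/-- `dec` is a maximum likelihood decoder with full channel state information at the fusion center:
from `h` and `u` it outputs a maximizer of `Pr(u | s, h)` over the constellation.  Ties are broken
arbitrarily. -/
def IsMLDecoder (S : Constellation M) (label : Fin M ≃ (Fin K → F))
    (G : Matrix (Fin K) (Fin N) F) (det : ℝ → Fin N → ℂ → ℂ → Fin M)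
    (dec : ℝ → (Fin N → ℂ) → (Fin N → F) → Fin M) : Prop :=
  ∀ ρ, 0 < ρ → ∀ h u m,
    likelihood S label G det ρ h u m ≤ likelihood S label G det ρ h u (dec ρ h u)

/-- The symbol error probability at the fusion center conditioned on the channel vector `h`, for
equiprobable symbols. -/
def condErrorProb (S : Constellation M) (label : Fin M ≃ (Fin K → F))
    (G : Matrix (Fin K) (Fin N) F) (det : ℝ → Fin N → ℂ → ℂ → Fin M)
    (dec : ℝ → (Fin N → ℂ) → (Fin N → F) → Fin M) (ρ : ℝ) (h : Fin N → ℂ) : ℝ :=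
  (1 / (M : ℝ)) *
    ∑ m, (stdCNVec N).real {n | dec ρ h (nodeOutput S label G det ρ h m n) ≠ m}

/-- The average symbol error probability, i.e. the expectation of the conditional one over the
i.i.d. Rayleigh fading channel. -/
def errorProb (S : Constellation M) (label : Fin M ≃ (Fin K → F))
    (G : Matrix (Fin K) (Fin N) F) (det : ℝ → Fin N → ℂ → ℂ → Fin M)
    (dec : ℝ → (Fin N → ℂ) → (Fin N → F) → Fin M) (ρ : ℝ) : ℝ :=
  ∫ h, condErrorProb S label G det dec ρ h ∂(stdCNVec N)

/-- The error probability `P` has diversity order `d`: `-lim_{ρ → ∞} log P(ρ) / log ρ = d`, where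
`P(ρ)` is positive for large `ρ`, so that its logarithm makes sense. -/
def HasDiversityOrder (P : ℝ → ℝ) (d : ℝ) : Prop :=
  (∀ᶠ ρ in atTop, 0 < P ρ) ∧ Tendsto (fun ρ => -(Real.log (P ρ) / Real.log ρ)) atTop (𝓝 d)

end CodedDiversity

end

/-!
The likelihood `Pr(u | s_m, h)` is a product over the nodes, because the noises are independent.
All the bounds are on its factors, `nodeLikelihood`, and the average over `h` factorises in turn
because the fading coefficients are independent.

*Upper bound.* If the decoder errs on `u` and outputs `m' ≠ m`, then
`Pr(u | m) ≤ √(Pr(u | m) Pr(u | m'))`, which is again a product over the nodes. At a node where the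
codewords of `m` and `m'` differ, `u_i` is wrong for one of the two symbols, so the Gaussian tail
makes the factor at most `2 exp(-a ρ |h_i|²)` (`IsHardDecision.sqrt_nodeLikelihood_mul_le`). The
average of this over Rayleigh fading is `2 / (1 + a ρ)`, and there are at least `dmin` such nodes,
so `P_e(ρ) = O(ρ ^ (-dmin))` (`IsMLDecoder.errorProb_le`). Minimum Hamming distance decoding
would only guarantee about half this exponent.

*Lower bound.* Let the codewords of `m ≠ m'` differ in exactly `dmin` places. With probability of
order `1 / ρ` at each of these, and of order `1` elsewhere, the coefficients satisfy
`1/2 ≤ |h_i| √ρ`, and `|h_i| √ρ ≤ 1` where the codewords differ. Every node then forwards the symbol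
of the codeword of `m` with probability bounded below, whichever of `m`, `m'` was sent
(`IsHardDecision.le_nodeLikelihood`), so no decoder can tell them apart
(`IsMLDecoder.le_errorProb`).

The decoder may break ties non-measurably in `h`, but its conditional error probability is
`1 - (1/M) ∑_u max_m Pr(u | s_m, h)` (`IsMLDecoder.condErrorProb_eq`), which does not depend on the
ties and is measurable.
-/

open scoped Matrix
open MeasureTheory Filter Topology

noncomputable section

namespace CodedDiversity

/-! ### The complex Gaussian law -/

theorem integral_stdCN_eq (f : ℂ → ℝ) :
    ∫ z, f z ∂stdCN = ∫ z : ℂ, Real.pi⁻¹ * Real.exp (-‖z‖ ^ 2) * f z := by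
  rw [stdCN, integral_withDensity_eq_integral_toReal_smul (by fun_prop)
    (Eventually.of_forall fun _ => ENNReal.ofReal_lt_top)]
  refine integral_congr_ae (Eventually.of_forall fun z => ?_)
  simp only [smul_eq_mul]
  rw [ENNReal.toReal_ofReal (by positivity)]

theorem integral_exp_neg_mul_sq_stdCN {a : ℝ} (ha : -1 < a) :
    ∫ z, Real.exp (-a * ‖z‖ ^ 2) ∂stdCN = (1 + a)⁻¹ := by
  have h := Complex.integral_exp_neg_mul_rpow (p := 2) (b := 1 + a) (by norm_num) (by linarith)
  norm_num at h
  rw [integral_stdCN_eq]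
  have h2 : ∀ z : ℂ, Real.pi⁻¹ * Real.exp (-‖z‖ ^ 2) * Real.exp (-a * ‖z‖ ^ 2)
      = Real.pi⁻¹ * Real.exp ((-a + -1) * ‖z‖ ^ 2) := by
    intro z
    rw [mul_assoc, ← Real.exp_add]
    ring_nf
  simp_rw [h2]
  rw [integral_const_mul, h, Real.rpow_neg_one]
  field_simp

theorem integrable_exp_neg_mul_sq_stdCN {a : ℝ} (ha : -1 < a) :
    Integrable (fun z : ℂ => Real.exp (-a * ‖z‖ ^ 2)) stdCN := by
  by_contra hc
  have h := integral_exp_neg_mul_sq_stdCN ha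
  rw [integral_undef hc] at h
  have : 0 < (1 + a)⁻¹ := inv_pos.2 (by linarith)
  linarith

/-- Chernoff's bound for the Gaussian tail, from `E exp(|z|² / 2) = 2`. -/
theorem stdCN_tail_le {t : ℝ} (ht : 0 ≤ t) :
    stdCN.real {z | t ≤ ‖z‖} ≤ 2 * Real.exp (-(t ^ 2 / 2)) := by
  have h := mul_meas_ge_le_integral_of_nonneg (μ := stdCN)
    (f := fun z : ℂ => Real.exp (-(-1 / 2) * ‖z‖ ^ 2))
    (Eventually.of_forall fun z => (Real.exp_pos _).le)
    (integrable_exp_neg_mul_sq_stdCN (by norm_num)) (Real.exp (t ^ 2 / 2))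
  rw [integral_exp_neg_mul_sq_stdCN (by norm_num)] at h
  have hs : stdCN.real {z | t ≤ ‖z‖} ≤
      stdCN.real {z : ℂ | Real.exp (t ^ 2 / 2) ≤ Real.exp (-(-1 / 2) * ‖z‖ ^ 2)} := by
    refine measureReal_mono fun z (hz : t ≤ ‖z‖) => ?_
    simp only [Set.mem_ofPred_eq, Real.exp_le_exp]
    have := pow_le_pow_left₀ ht hz 2
    linarith
  rw [Real.exp_neg, ← div_eq_mul_inv, le_div_iff₀ (Real.exp_pos _)]
  calc _ ≤ _ := mul_le_mul_of_nonneg_right hs (Real.exp_pos _).le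
    _ ≤ 2 := by rw [mul_comm]; norm_num at h ⊢; exact h

/-- On a ball contained in `{|z| ≤ R}` the Gaussian density is at least `π⁻¹ exp(-R²)`. -/
theorem le_stdCN_ball {c : ℂ} {r R : ℝ} (hr : 0 ≤ r) (hR : ‖c‖ + r ≤ R) :
    r ^ 2 * Real.exp (-R ^ 2) ≤ stdCN.real (Metric.ball c r) := by
  have hle : ENNReal.ofReal (r ^ 2 * Real.exp (-R ^ 2)) ≤ stdCN (Metric.ball c r) := by
    rw [stdCN, withDensity_apply _ measurableSet_ball]
    have hb : ∀ z ∈ Metric.ball c r, ENNReal.ofReal (Real.pi⁻¹ * Real.exp (-R ^ 2)) ≤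
        ENNReal.ofReal (Real.pi⁻¹ * Real.exp (-‖z‖ ^ 2)) := by
      intro z hz
      have hz' : ‖z‖ ≤ R := by
        have h1 := norm_sub_norm_le z c
        have h2 : ‖z - c‖ < r := by simpa [dist_eq_norm] using hz
        linarith
      gcongr
    refine le_trans ?_ (setLIntegral_mono' measurableSet_ball hb)
    rw [setLIntegral_const, Complex.volume_ball, ← ENNReal.ofReal_coe_nnreal,
      ← ENNReal.ofReal_pow hr, ← ENNReal.ofReal_mul (by positivity),
      ← ENNReal.ofReal_mul (by positivity), NNReal.coe_real_pi]
    refine ENNReal.ofReal_le_ofReal (le_of_eq ?_)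
    field_simp
  exact (ENNReal.ofReal_le_iff_le_toReal (measure_ne_top _ _)).1 hle

/-! ### From power bounds to the diversity order -/

theorem hasDiversityOrder_of_bounds {P : ℝ → ℝ} {d : ℕ} {c C : ℝ} (hc : 0 < c)
    (hlow : ∀ ρ, 1 ≤ ρ → c * (ρ ^ d)⁻¹ ≤ P ρ) (hup : ∀ ρ, 1 ≤ ρ → P ρ ≤ C * (ρ ^ d)⁻¹) :
    HasDiversityOrder P d := by
  have hC : 0 < C := by
    have := (hlow 1 le_rfl).trans (hup 1 le_rfl)
    simp at this
    linarith
  have hpos : ∀ ρ, 1 ≤ ρ → 0 < P ρ := fun ρ hρ =>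
    lt_of_lt_of_le (by positivity) (hlow ρ hρ)
  refine ⟨(eventually_ge_atTop 1).mono hpos, ?_⟩
  have hlim : ∀ k : ℝ, Tendsto (fun ρ => (d : ℝ) - k / Real.log ρ) atTop (𝓝 d) := by
    intro k
    simpa using (tendsto_const_nhds (x := (d : ℝ))).sub
      (Real.tendsto_log_atTop.const_div_atTop k)
  have hlog : ∀ k ρ : ℝ, 0 < k → 1 < ρ →
      Real.log (k * (ρ ^ d)⁻¹) = Real.log k - d * Real.log ρ := by
    intro k ρ hk hρ
    rw [Real.log_mul hk.ne' (by positivity), Real.log_inv, Real.log_pow]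
    ring
  refine tendsto_of_tendsto_of_tendsto_of_le_of_le' (hlim (Real.log C)) (hlim (Real.log c))
    ?_ ?_
  all_goals
    filter_upwards [eventually_gt_atTop 1] with ρ hρ
    have hl := Real.log_pos hρ
  · have h := Real.log_le_log (hpos ρ hρ.le) (hup ρ hρ.le)
    rw [hlog C ρ hC hρ] at h
    rw [← neg_div, le_div_iff₀ hl, sub_mul, div_mul_cancel₀ _ hl.ne']
    linarith
  · have h := Real.log_le_log (by positivity) (hlow ρ hρ.le)
    rw [hlog c ρ hc hρ] at h
    rw [← neg_div, div_le_iff₀ hl, sub_mul, div_mul_cancel₀ _ hl.ne']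
    linarith

/-! ### Likelihoods and their factorisation over the nodes -/

instance (N : ℕ) : IsProbabilityMeasure (stdCNVec N) := by
  unfold stdCNVec; infer_instance

variable {F : Type*} [Field F] {N K M : ℕ} {S : Constellation M} {label : Fin M ≃ (Fin K → F)}
  {G : Matrix (Fin K) (Fin N) F} {det : ℝ → Fin N → ℂ → ℂ → Fin M}
  {dec : ℝ → (Fin N → ℂ) → (Fin N → F) → Fin M}

theorem Constellation.exists_separation (S : Constellation M) :
    ∃ δ > 0, ∀ m m', m ≠ m' → δ ≤ ‖S.point m - S.point m'‖ := by
  classical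
  obtain h | h := isEmpty_or_nonempty {p : Fin M × Fin M // p.1 ≠ p.2}
  · exact ⟨1, one_pos, fun m m' hm => (h.false ⟨(m, m'), hm⟩).elim⟩
  · obtain ⟨p, hp⟩ := Finite.exists_min
      fun p : {p : Fin M × Fin M // p.1 ≠ p.2} => ‖S.point p.1.1 - S.point p.1.2‖
    exact ⟨_, norm_pos_iff.2 (sub_ne_zero.2 fun he => p.2 (S.injective he)),
      fun m m' hm => hp ⟨(m, m'), hm⟩⟩

theorem Constellation.exists_diameter_bound (S : Constellation M) :
    ∃ R, ∀ m m', ‖S.point m - S.point m'‖ ≤ R := by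
  obtain ⟨R, hR⟩ := (Set.finite_range
    fun p : Fin M × Fin M => ‖S.point p.1 - S.point p.2‖).bddAbove
  exact ⟨R, fun m m' => hR ⟨(m, m'), rfl⟩⟩

theorem Constellation.norm_mul_symbol_sub (S : Constellation M) (ρ : ℝ) (h : ℂ) (m m' : Fin M) :
    ‖h * S.symbol ρ m - h * S.symbol ρ m'‖ =
      ‖h‖ * Real.sqrt ρ * ‖S.point m - S.point m'‖ := by
  simp only [Constellation.symbol]
  rw [← mul_sub, ← mul_sub, norm_mul, norm_mul, Complex.norm_real, Real.norm_eq_abs,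
    abs_of_nonneg (Real.sqrt_nonneg ρ), mul_assoc]

/-- The probability that node `i`, with channel coefficient `h`, forwards `v` when `s_m` is sent. -/
def nodeLikelihood (S : Constellation M) (label : Fin M ≃ (Fin K → F))
    (G : Matrix (Fin K) (Fin N) F) (det : ℝ → Fin N → ℂ → ℂ → Fin M)
    (ρ : ℝ) (i : Fin N) (h : ℂ) (v : F) (m : Fin M) : ℝ :=
  stdCN.real {n | codeword label G (det ρ i h (h * S.symbol ρ m + n)) i = v}

theorem nodeLikelihood_nonneg (ρ : ℝ) (i : Fin N) (h : ℂ) (v : F) (m : Fin M) :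
    0 ≤ nodeLikelihood S label G det ρ i h v m := measureReal_nonneg

theorem nodeLikelihood_le_one (ρ : ℝ) (i : Fin N) (h : ℂ) (v : F) (m : Fin M) :
    nodeLikelihood S label G det ρ i h v m ≤ 1 := measureReal_le_one

theorem setOf_nodeOutput_eq (ρ : ℝ) (h : Fin N → ℂ) (u : Fin N → F) (m : Fin M) :
    {n | nodeOutput S label G det ρ h m n = u} = Set.pi Set.univ fun i =>
      {n | codeword label G (det ρ i (h i) (h i * S.symbol ρ m + n)) i = u i} := by
  ext n
  simp only [Set.mem_ofPred_eq, funext_iff, Set.mem_pi, Set.mem_univ, true_imp_iff]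
  rfl

theorem likelihood_eq_prod (ρ : ℝ) (h : Fin N → ℂ) (u : Fin N → F) (m : Fin M) :
    likelihood S label G det ρ h u m =
      ∏ i, nodeLikelihood S label G det ρ i (h i) (u i) m := by
  rw [likelihood, setOf_nodeOutput_eq, stdCNVec, measureReal_def, Measure.pi_pi,
    ENNReal.toReal_prod]
  rfl

theorem likelihood_nonneg (ρ : ℝ) (h : Fin N → ℂ) (u : Fin N → F) (m : Fin M) :
    0 ≤ likelihood S label G det ρ h u m := measureReal_nonneg

theorem IsHardDecision.measurableSet_eq (hdet : IsHardDecision S det) (ρ : ℝ) (i : Fin N) (v : F)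
    (m : Fin M) : MeasurableSet
      {p : ℂ × ℂ | codeword label G (det ρ i p.1 (p.1 * S.symbol ρ m + p.2)) i = v} := by
  have hm : Measurable fun p : ℂ × ℂ => det ρ i p.1 (p.1 * S.symbol ρ m + p.2) :=
    (hdet.measurable ρ i).comp (f := fun p : ℂ × ℂ => (p.1, p.1 * S.symbol ρ m + p.2))
      (by fun_prop)
  exact hm (MeasurableSet.of_discrete (s := {k | codeword label G k i = v}))

theorem IsHardDecision.measurableSet_nodeOutput_eq (hdet : IsHardDecision S det) (ρ : ℝ)
    (h : Fin N → ℂ) (u : Fin N → F) (m : Fin M) :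
    MeasurableSet {n | nodeOutput S label G det ρ h m n = u} := by
  rw [setOf_nodeOutput_eq]
  exact MeasurableSet.univ_pi fun i =>
    measurable_prodMk_left (hdet.measurableSet_eq ρ i (u i) m)

theorem IsHardDecision.measurable_likelihood (hdet : IsHardDecision S det) (ρ : ℝ)
    (u : Fin N → F) (m : Fin M) :
    Measurable fun h => likelihood S label G det ρ h u m := by
  simp_rw [likelihood_eq_prod]
  refine Finset.measurable_prod _ fun i _ => ?_
  have := (measurable_measure_prodMk_left (ν := stdCN)
    (hdet.measurableSet_eq (label := label) (G := G) ρ i (u i) m)).ennreal_toReal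
  exact this.comp (measurable_pi_apply i)

/-! ### Bounds at a single node -/

/-- A node forwards a wrong code symbol only if its noise is at least half the distance between two
points of the received constellation `h √ρ x_m`. -/
theorem IsHardDecision.nodeLikelihood_le (hdet : IsHardDecision S det) {δ : ℝ} (hδ : 0 < δ)
    (hsep : ∀ m m', m ≠ m' → δ ≤ ‖S.point m - S.point m'‖) {ρ : ℝ} (hρ : 0 < ρ) (i : Fin N)
    (h : ℂ) {v : F} {m : Fin M} (hv : codeword label G m i ≠ v) :
    nodeLikelihood S label G det ρ i h v m ≤ 2 * Real.exp (-(δ ^ 2 / 8 * ρ * ‖h‖ ^ 2)) := by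
  have hsub : {n | codeword label G (det ρ i h (h * S.symbol ρ m + n)) i = v} ⊆
      {n | ‖h‖ * Real.sqrt ρ * δ / 2 ≤ ‖n‖} := by
    intro n hn
    simp only [Set.mem_ofPred_eq] at hn ⊢
    set k := det ρ i h (h * S.symbol ρ m + n) with hk
    have hmk : m ≠ k := fun e => hv (e ▸ hn)
    have h1 := hdet.min_dist ρ hρ i h (h * S.symbol ρ m + n) m
    rw [← hk, add_sub_cancel_left] at h1
    have h2 := S.norm_mul_symbol_sub ρ h m k
    have h3 : ‖h * S.symbol ρ m - h * S.symbol ρ k‖ ≤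
        ‖h * S.symbol ρ m + n - h * S.symbol ρ k‖ + ‖n‖ := by
      refine le_trans (le_of_eq ?_) (norm_sub_le _ n)
      congr 1
      ring
    have h4 : ‖h‖ * Real.sqrt ρ * δ ≤ ‖h‖ * Real.sqrt ρ * ‖S.point m - S.point k‖ := by
      gcongr
      exact hsep m k hmk
    linarith
  refine (measureReal_mono hsub).trans ((stdCN_tail_le (by positivity)).trans (le_of_eq ?_))
  have : (‖h‖ * Real.sqrt ρ * δ / 2) ^ 2 / 2 = δ ^ 2 / 8 * ρ * ‖h‖ ^ 2 := by
    rw [div_pow, mul_pow, mul_pow, Real.sq_sqrt hρ.le]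
    ring
  rw [this]

/-- When the codewords of `m` and `m'` differ at node `i`, any `v` is a wrong code symbol for at
least one of them. -/
theorem IsHardDecision.sqrt_nodeLikelihood_mul_le (hdet : IsHardDecision S det) {δ : ℝ}
    (hδ : 0 < δ) (hsep : ∀ m m', m ≠ m' → δ ≤ ‖S.point m - S.point m'‖) {ρ : ℝ} (hρ : 0 < ρ)
    (i : Fin N) (h : ℂ) (v : F) {m m' : Fin M}
    (hne : codeword label G m i ≠ codeword label G m' i) :
    √(nodeLikelihood S label G det ρ i h v m * nodeLikelihood S label G det ρ i h v m') ≤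
      2 * Real.exp (-(δ ^ 2 / 16 * ρ) * ‖h‖ ^ 2) := by
  have hmul : nodeLikelihood S label G det ρ i h v m * nodeLikelihood S label G det ρ i h v m' ≤
      2 * Real.exp (-(δ ^ 2 / 8 * ρ * ‖h‖ ^ 2)) := by
    by_cases hv : codeword label G m i = v
    · refine (mul_le_of_le_one_left (nodeLikelihood_nonneg ..)
        (nodeLikelihood_le_one ..)).trans (hdet.nodeLikelihood_le hδ hsep hρ i h ?_)
      exact fun e => hne (hv.trans e.symm)
    · exact (mul_le_of_le_one_right (nodeLikelihood_nonneg ..)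
        (nodeLikelihood_le_one ..)).trans (hdet.nodeLikelihood_le hδ hsep hρ i h hv)
  refine Real.sqrt_le_iff.2 ⟨by positivity, hmul.trans ?_⟩
  rw [mul_pow, ← Real.exp_nat_mul]
  have : -(δ ^ 2 / 8 * ρ * ‖h‖ ^ 2) = ((2 : ℕ) : ℝ) * (-(δ ^ 2 / 16 * ρ) * ‖h‖ ^ 2) := by
    push_cast
    ring
  rw [this]
  gcongr
  norm_num

/-- Noise close to `h (s_m' - s_m)` makes the node detect `m'` when `m` was sent. The lower bound on
`|h| √ρ` keeps the decision region of `m'` from shrinking below the noise scale, and the upper bound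
keeps the required noise bounded; the latter is not needed for `m = m'`. -/
theorem IsHardDecision.le_nodeLikelihood (hdet : IsHardDecision S det) {δ R : ℝ} (hδ : 0 < δ)
    (hsep : ∀ m m', m ≠ m' → δ ≤ ‖S.point m - S.point m'‖)
    (hR : ∀ m m', ‖S.point m - S.point m'‖ ≤ R) {ρ : ℝ} (hρ : 0 < ρ) (i : Fin N)
    {h : ℂ} {m m' : Fin M} (hlow : 1 / 2 ≤ ‖h‖ * √ρ) (hup : m = m' ∨ ‖h‖ * √ρ ≤ 1) :
    (δ / 4) ^ 2 * Real.exp (-(R + δ / 4) ^ 2) ≤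
      nodeLikelihood S label G det ρ i h (codeword label G m' i) m := by
  have hc : ‖h * S.symbol ρ m' - h * S.symbol ρ m‖ + δ / 4 ≤ R + δ / 4 := by
    gcongr
    obtain rfl | hup := hup
    · simpa using (norm_nonneg _).trans (hR m m)
    · rw [S.norm_mul_symbol_sub]
      exact (mul_le_of_le_one_left (norm_nonneg _) hup).trans (hR _ _)
  refine (le_stdCN_ball (by positivity) hc).trans (measureReal_mono fun n hn => ?_)
  simp only [Set.mem_ofPred_eq]
  set y := h * S.symbol ρ m + n with hy
  have hym : ‖y - h * S.symbol ρ m'‖ < δ / 4 := by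
    have : y - h * S.symbol ρ m' = n - (h * S.symbol ρ m' - h * S.symbol ρ m) := by
      rw [hy]; ring
    rw [this]
    simpa [dist_eq_norm] using hn
  suffices hk : det ρ i h y = m' by rw [hk]
  by_contra hk
  have h1 := hdet.min_dist ρ hρ i h y m'
  have h2 := S.norm_mul_symbol_sub ρ h m' (det ρ i h y)
  have h3 : ‖h * S.symbol ρ m' - h * S.symbol ρ (det ρ i h y)‖ ≤
      ‖y - h * S.symbol ρ (det ρ i h y)‖ + ‖y - h * S.symbol ρ m'‖ := by
    refine le_trans (le_of_eq ?_) (norm_sub_le _ _)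
    congr 1
    ring
  have h4 : 1 / 2 * δ ≤ ‖h‖ * √ρ * ‖S.point m' - S.point (det ρ i h y)‖ := by
    gcongr
    exact hsep _ _ (Ne.symm hk)
  linarith

/-! ### The conditional error probability of the decoder -/

theorem IsHardDecision.measureReal_dec_ne [Fintype F] [DecidableEq F]
    (hdet : IsHardDecision S det)
    (ρ : ℝ) (h : Fin N → ℂ) (m : Fin M) :
    (stdCNVec N).real {n | dec ρ h (nodeOutput S label G det ρ h m n) ≠ m} =
      ∑ u with dec ρ h u ≠ m, likelihood S label G det ρ h u m := by
  have hU : {n | dec ρ h (nodeOutput S label G det ρ h m n) ≠ m} =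
      ⋃ u ∈ Finset.univ.filter (fun u => dec ρ h u ≠ m),
        {n | nodeOutput S label G det ρ h m n = u} := by
    ext n
    simp
  rw [hU, measureReal_biUnion_finset]
  · rfl
  · intro u _ v _ huv
    exact Set.disjoint_left.2 fun n hn hn' => huv (hn.symm.trans hn')
  · exact fun u _ => hdet.measurableSet_nodeOutput_eq ρ h u m

theorem IsHardDecision.sum_likelihood [Fintype F] [DecidableEq F] (hdet : IsHardDecision S det)
    (ρ : ℝ) (h : Fin N → ℂ) (m : Fin M) :
    ∑ u, likelihood S label G det ρ h u m = 1 := by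
  have hU : (Set.univ : Set (Fin N → ℂ)) = ⋃ u ∈ (Finset.univ : Finset (Fin N → F)),
      {n | nodeOutput S label G det ρ h m n = u} := by
    ext n
    simp
  rw [← probReal_univ (μ := stdCNVec N), hU, measureReal_biUnion_finset]
  · rfl
  · intro u _ v _ huv
    exact Set.disjoint_left.2 fun n hn hn' => huv (hn.symm.trans hn')
  · exact fun u _ => hdet.measurableSet_nodeOutput_eq ρ h u m

/-- The right-hand side does not involve `dec`, so it is measurable in `h` although the
tie-breaking of `dec` need not be. -/
theorem IsMLDecoder.condErrorProb_eq [Fintype F] [DecidableEq F] [NeZero M]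
    (hdet : IsHardDecision S det) (hdec : IsMLDecoder S label G det dec) {ρ : ℝ} (hρ : 0 < ρ)
    (h : Fin N → ℂ) :
    condErrorProb S label G det dec ρ h = (1 / (M : ℝ)) * (M - ∑ u,
      Finset.univ.sup' Finset.univ_nonempty fun m => likelihood S label G det ρ h u m) := by
  have hmax : ∀ u, (Finset.univ.sup' Finset.univ_nonempty
      fun m => likelihood S label G det ρ h u m) = likelihood S label G det ρ h u (dec ρ h u) :=
    fun u => le_antisymm (Finset.sup'_le _ _ fun m _ => hdec ρ hρ h u m)
      (Finset.le_sup' (fun m => likelihood S label G det ρ h u m) (Finset.mem_univ _))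
  rw [condErrorProb]
  congr 1
  simp_rw [hmax, hdet.measureReal_dec_ne]
  have hone : ∀ m, ∑ u with dec ρ h u ≠ m, likelihood S label G det ρ h u m =
      1 - ∑ u with dec ρ h u = m, likelihood S label G det ρ h u m := by
    intro m
    rw [← hdet.sum_likelihood (label := label) (G := G) ρ h m,
      ← Finset.sum_filter_add_sum_filter_not Finset.univ (fun u => dec ρ h u = m)]
    ring
  simp_rw [hone]
  rw [Finset.sum_sub_distrib]
  congr 1
  · simp
  · simp_rw [Finset.sum_filter]
    rw [Finset.sum_comm]
    simp

theorem condErrorProb_nonneg (ρ : ℝ) (h : Fin N → ℂ) :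
    0 ≤ condErrorProb S label G det dec ρ h :=
  mul_nonneg (by positivity) (Finset.sum_nonneg fun _ _ => measureReal_nonneg)

theorem IsMLDecoder.integrable_condErrorProb [Fintype F] [DecidableEq F] [NeZero M]
    (hdet : IsHardDecision S det) (hdec : IsMLDecoder S label G det dec) {ρ : ℝ} (hρ : 0 < ρ) :
    Integrable (condErrorProb S label G det dec ρ) (stdCNVec N) := by
  have hmeas : Measurable (condErrorProb S label G det dec ρ) := by
    rw [funext (hdec.condErrorProb_eq hdet hρ)]
    refine (measurable_const.sub (Finset.measurable_sum _ fun u _ => ?_)).const_mul _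
    have := Finset.measurable_sup' (Finset.univ_nonempty (α := Fin M))
      (f := fun m h => likelihood S label G det ρ h u m)
      fun m _ => hdet.measurable_likelihood ρ u m
    convert this using 2 with h
    rw [Finset.sup'_apply]
  refine Integrable.of_bound hmeas.aestronglyMeasurable 1 (Eventually.of_forall fun h => ?_)
  rw [Real.norm_eq_abs, abs_of_nonneg (condErrorProb_nonneg ρ h), condErrorProb]
  have hM : (0 : ℝ) < M := by exact_mod_cast Nat.pos_of_ne_zero (NeZero.ne M)
  rw [one_div, inv_mul_le_iff₀ hM, mul_one]
  refine (Finset.sum_le_sum fun m _ => measureReal_le_one).trans ?_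
  simp

/-! ### The lower bound on the error probability -/

theorem exists_dmin [DecidableEq F] [Fact (1 < M)] (label : Fin M ≃ (Fin K → F))
    (G : Matrix (Fin K) (Fin N) F) : ∃ m m', m ≠ m' ∧
      hammingDist (codeword label G m) (codeword label G m') = dmin label G := by
  have hM : 1 < M := Fact.out
  obtain ⟨m, m', hne, he⟩ := Nat.sInf_mem (s := {d | ∃ m m' : Fin M, m ≠ m' ∧
    d = hammingDist (codeword label G m) (codeword label G m')})
    ⟨_, ⟨0, by omega⟩, ⟨1, hM⟩, by simp, rfl⟩
  exact ⟨m, m', hne, he.symm⟩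

theorem dmin_le_hammingDist [DecidableEq F] {m m' : Fin M} (hne : m ≠ m') :
    dmin label G ≤ hammingDist (codeword label G m) (codeword label G m') :=
  Nat.sInf_le ⟨m, m', hne, rfl⟩

/-- Whatever the decoder makes of `u`, it errs on `u` for at least one of `m` and `m'`. -/
theorem min_likelihood_le_condErrorProb (ρ : ℝ) (h : Fin N → ℂ) (u : Fin N → F) {m m' : Fin M}
    (hne : m ≠ m') :
    (1 / (M : ℝ)) * min (likelihood S label G det ρ h u m) (likelihood S label G det ρ h u m') ≤
      condErrorProb S label G det dec ρ h := by
  rw [condErrorProb]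
  gcongr
  have hk : ∀ k, dec ρ h u ≠ k → likelihood S label G det ρ h u k ≤
      ∑ k, (stdCNVec N).real {n | dec ρ h (nodeOutput S label G det ρ h k n) ≠ k} := by
    intro k hk
    refine le_trans (measureReal_mono fun n hn => ?_) (Finset.single_le_sum
      (f := fun k => (stdCNVec N).real {n | dec ρ h (nodeOutput S label G det ρ h k n) ≠ k})
      (fun _ _ => measureReal_nonneg) (Finset.mem_univ k))
    simp only [Set.mem_ofPred_eq] at hn ⊢
    rwa [hn]
  by_cases hm : dec ρ h u = m
  · exact (min_le_right _ _).trans (hk m' fun e => hne (hm.symm.trans e))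
  · exact (min_le_left _ _).trans (hk m hm)

theorem prod_ite_eq_pow_hammingDist {α : Type*} [DecidableEq α] (c c' : Fin N → α) (x : ℝ) :
    ∏ i, (if c i ≠ c' i then x else 1) = x ^ hammingDist c c' := by
  rw [Finset.prod_ite, Finset.prod_const, Finset.prod_const_one, mul_one]
  rfl

theorem IsMLDecoder.le_errorProb [Fintype F] [DecidableEq F] [Fact (1 < M)]
    (hdet : IsHardDecision S det) (hdec : IsMLDecoder S label G det dec) :
    ∃ c > 0, ∀ ρ, 1 ≤ ρ → c * (ρ ^ dmin label G)⁻¹ ≤ errorProb S label G det dec ρ := by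
  have hM : 1 < M := Fact.out
  have : NeZero M := ⟨by omega⟩
  obtain ⟨δ, hδ, hsep⟩ := S.exists_separation
  obtain ⟨R, hR⟩ := S.exists_diameter_bound
  obtain ⟨m, m', hne, hd⟩ := exists_dmin label G
  set κ := (δ / 4) ^ 2 * Real.exp (-(R + δ / 4) ^ 2) with hκ
  have hκ0 : 0 < κ := by positivity
  have hM0 : (0 : ℝ) < M := by exact_mod_cast (by omega : 0 < M)
  refine ⟨(1 / (M : ℝ)) * κ ^ N * (Real.exp (-1) / 16) ^ N, by positivity, fun ρ hρ => ?_⟩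
  have hρ0 : 0 < ρ := by linarith
  have hs0 : 0 < √ρ := Real.sqrt_pos.2 hρ0
  have hs1 : 1 ≤ √ρ := Real.one_le_sqrt.2 hρ
  let c := codeword label G
  -- `t i` is the scale of `|h_i|`: a deep fade where the two codewords differ, no fade elsewhere.
  let t : Fin N → ℝ := fun i => if c m i ≠ c m' i then (√ρ)⁻¹ else 1
  have ht0 : ∀ i, 0 < t i := fun i => by dsimp only [t]; split_ifs <;> positivity
  have ht1 : ∀ i, t i ≤ 1 := fun i => by
    dsimp only [t]; split_ifs
    · exact inv_le_one_of_one_le₀ hs1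
    · exact le_rfl
  -- Each ball lies in the annulus `t i / 2 ≤ |z| ≤ t i`.
  let box : Set (Fin N → ℂ) :=
    Set.pi Set.univ fun i => Metric.ball ((3 / 4 * t i : ℝ) : ℂ) (1 / 4 * t i)
  have hball : ∀ h ∈ box, ∀ i, 1 / 2 * t i ≤ ‖h i‖ ∧ ‖h i‖ ≤ t i := by
    intro h hh i
    have h1 : ‖h i - ((3 / 4 * t i : ℝ) : ℂ)‖ < 1 / 4 * t i := by
      have := hh i (Set.mem_univ i)
      rwa [Metric.mem_ball, dist_eq_norm] at this
    have h2 := norm_sub_norm_le (h i) ((3 / 4 * t i : ℝ) : ℂ)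
    have h3 := norm_sub_norm_le ((3 / 4 * t i : ℝ) : ℂ) (h i)
    rw [norm_sub_rev] at h3
    have hn : ‖((3 / 4 * t i : ℝ) : ℂ)‖ = 3 / 4 * t i := by
      rw [Complex.norm_real, Real.norm_eq_abs, abs_of_pos (by linarith [ht0 i])]
    rw [hn] at h2 h3
    constructor <;> linarith
  have hlow : ∀ h ∈ box, ∀ i, 1 / 2 ≤ ‖h i‖ * √ρ := by
    intro h hh i
    have h1 : 1 ≤ t i * √ρ := by
      dsimp only [t]; split_ifs
      · rw [inv_mul_cancel₀ hs0.ne']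
      · simpa using hs1
    have h2 : 1 / 2 * t i * √ρ ≤ ‖h i‖ * √ρ := by
      gcongr
      exact (hball h hh i).1
    linarith
  have hcond : ∀ h ∈ box, (1 / (M : ℝ)) * κ ^ N ≤ condErrorProb S label G det dec ρ h := by
    intro h hh
    refine le_trans ?_ (min_likelihood_le_condErrorProb ρ h (c m) hne)
    gcongr
    have hprod : ∀ k, (∀ i, κ ≤ nodeLikelihood S label G det ρ i (h i) (c m i) k) →
        κ ^ N ≤ likelihood S label G det ρ h (c m) k := by
      intro k hk
      rw [likelihood_eq_prod]
      calc κ ^ N = ∏ _i : Fin N, κ := by simp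
        _ ≤ _ := Finset.prod_le_prod (fun _ _ => hκ0.le) fun i _ => hk i
    refine le_min (hprod m fun i => ?_) (hprod m' fun i => ?_)
    · exact hdet.le_nodeLikelihood hδ hsep hR hρ0 i (hlow h hh i) (Or.inl rfl)
    · by_cases hi : c m i = c m' i
      · rw [hi]
        exact hdet.le_nodeLikelihood hδ hsep hR hρ0 i (hlow h hh i) (Or.inl rfl)
      · refine hdet.le_nodeLikelihood hδ hsep hR hρ0 i (hlow h hh i) (Or.inr ?_)
        have h1 := (hball h hh i).2
        simp only [t, ne_eq, hi, not_false_eq_true, if_true] at h1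
        calc ‖h i‖ * √ρ ≤ (√ρ)⁻¹ * √ρ := by gcongr
          _ = 1 := inv_mul_cancel₀ hs0.ne'
  have hbox : (Real.exp (-1) / 16) ^ N * (ρ ^ dmin label G)⁻¹ ≤ (stdCNVec N).real box := by
    rw [stdCNVec, measureReal_def, Measure.pi_pi, ENNReal.toReal_prod]
    have h1 : (Real.exp (-1) / 16) ^ N * (ρ ^ dmin label G)⁻¹ =
        ∏ i, (Real.exp (-1) / 16 * if c m i ≠ c m' i then ρ⁻¹ else 1) := by
      rw [Finset.prod_mul_distrib, prod_ite_eq_pow_hammingDist, hd, inv_pow, Finset.prod_const,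
        Finset.card_univ, Fintype.card_fin]
    rw [h1]
    refine Finset.prod_le_prod (fun i _ => by split_ifs <;> positivity) fun i _ => ?_
    have hti : (if c m i ≠ c m' i then ρ⁻¹ else 1) = t i ^ 2 := by
      dsimp only [t]; split_ifs
      · rw [inv_pow, Real.sq_sqrt hρ0.le]
      · simp
    rw [hti]
    refine le_trans (le_of_eq ?_) (le_stdCN_ball (R := 1) (by linarith [ht0 i]) ?_)
    · rw [one_pow]; ring
    · rw [Complex.norm_real, Real.norm_eq_abs, abs_of_pos (by linarith [ht0 i])]
      linarith [ht1 i]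
  have hmk := mul_meas_ge_le_integral_of_nonneg
    (Eventually.of_forall fun h => condErrorProb_nonneg ρ h)
    (hdec.integrable_condErrorProb hdet hρ0) ((1 / (M : ℝ)) * κ ^ N)
  refine le_trans ?_ hmk
  rw [mul_assoc]
  gcongr
  exact hbox.trans (measureReal_mono hcond)

/-! ### The upper bound on the error probability -/

/-- The Bhattacharyya bound `min a b ≤ √(a b)`, applied to the symbol sent and the decoder's
choice: each coordinate in which their codewords differ contributes a factor decaying in
`ρ |h_i|²`. -/
theorem IsMLDecoder.condErrorProb_le [Fintype F] [DecidableEq F]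
    (hdet : IsHardDecision S det) (hdec : IsMLDecoder S label G det dec) {δ : ℝ} (hδ : 0 < δ)
    (hsep : ∀ m m', m ≠ m' → δ ≤ ‖S.point m - S.point m'‖) {ρ : ℝ} (hρ : 0 < ρ)
    (h : Fin N → ℂ) :
    condErrorProb S label G det dec ρ h ≤ (1 / (M : ℝ)) * ∑ m, ∑ _u : Fin N → F,
      ∑ m' with m' ≠ m, ∏ i, if codeword label G m i ≠ codeword label G m' i then
        2 * Real.exp (-(δ ^ 2 / 16 * ρ) * ‖h i‖ ^ 2) else 1 := by
  rw [condErrorProb]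
  gcongr with m
  rw [hdet.measureReal_dec_ne]
  rw [Finset.sum_filter]
  gcongr with u
  have hnn : ∀ k m', m' ∈ Finset.univ.filter (fun m' : Fin M => m' ≠ k) →
      0 ≤ ∏ i, if codeword label G k i ≠ codeword label G m' i then
        2 * Real.exp (-(δ ^ 2 / 16 * ρ) * ‖h i‖ ^ 2) else 1 :=
    fun k m' _ => Finset.prod_nonneg fun i _ => by split_ifs <;> positivity
  split_ifs with hu
  · refine le_trans ?_ (Finset.single_le_sum (hnn m)
      (Finset.mem_filter.2 ⟨Finset.mem_univ (dec ρ h u), hu⟩))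
    calc likelihood S label G det ρ h u m
        ≤ √(likelihood S label G det ρ h u m * likelihood S label G det ρ h u (dec ρ h u)) := by
          refine Real.le_sqrt_of_sq_le ?_
          rw [sq]
          exact mul_le_mul_of_nonneg_left (hdec ρ hρ h u m) (likelihood_nonneg ..)
      _ = ∏ i, √(nodeLikelihood S label G det ρ i (h i) (u i) m *
            nodeLikelihood S label G det ρ i (h i) (u i) (dec ρ h u)) := by
          rw [likelihood_eq_prod, likelihood_eq_prod, ← Finset.prod_mul_distrib,
            Real.sqrt_prod _ fun i _ =>
              mul_nonneg (nodeLikelihood_nonneg ..) (nodeLikelihood_nonneg ..)]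
      _ ≤ _ := by
          refine Finset.prod_le_prod (fun _ _ => Real.sqrt_nonneg _) fun i _ => ?_
          split_ifs with hi
          · exact hdet.sqrt_nodeLikelihood_mul_le hδ hsep hρ i (h i) (u i) hi
          · exact Real.sqrt_le_one.2 (mul_le_one₀ (nodeLikelihood_le_one ..)
              (nodeLikelihood_nonneg ..) (nodeLikelihood_le_one ..))
  · exact Finset.sum_nonneg (hnn m)

theorem IsMLDecoder.errorProb_le [Fintype F] [DecidableEq F] [NeZero M]
    (hdet : IsHardDecision S det) (hdec : IsMLDecoder S label G det dec) :
    ∃ C, ∀ ρ, 1 ≤ ρ → errorProb S label G det dec ρ ≤ C * (ρ ^ dmin label G)⁻¹ := by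
  obtain ⟨δ, hδ, hsep⟩ := S.exists_separation
  refine ⟨(1 / (M : ℝ)) * ∑ m : Fin M, ∑ _u : Fin N → F, ∑ m' with m' ≠ m,
    (2 / (δ ^ 2 / 16)) ^ hammingDist (codeword label G m) (codeword label G m'),
    fun ρ hρ => ?_⟩
  have hρ0 : 0 < ρ := by linarith
  set a := δ ^ 2 / 16 with ha
  have ha0 : 0 < a := by positivity
  let φ : Fin M → Fin M → Fin N → ℂ → ℝ := fun m m' i z =>
    if codeword label G m i ≠ codeword label G m' i then
      2 * Real.exp (-(a * ρ) * ‖z‖ ^ 2) else 1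
  have hφ : ∀ m m', Integrable (fun h : Fin N → ℂ => ∏ i, φ m m' i (h i)) (stdCNVec N) := by
    intro m m'
    refine Integrable.fintype_prod (f := φ m m') fun i => ?_
    dsimp only [φ]
    split_ifs
    · exact (integrable_exp_neg_mul_sq_stdCN (by nlinarith)).const_mul 2
    · exact integrable_const 1
  have hint : ∀ m m', m' ≠ m → ∫ h, ∏ i, φ m m' i (h i) ∂(stdCNVec N) ≤
      (2 / a) ^ hammingDist (codeword label G m) (codeword label G m') *
        (ρ ^ dmin label G)⁻¹ := by
    intro m m' hne
    rw [stdCNVec, integral_fintype_prod_eq_prod (f := φ m m')]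
    have h1 : ∀ i, ∫ z, φ m m' i z ∂stdCN =
        if codeword label G m i ≠ codeword label G m' i then 2 * (1 + a * ρ)⁻¹ else 1 := by
      intro i
      dsimp only [φ]
      split_ifs
      · rw [integral_const_mul, integral_exp_neg_mul_sq_stdCN (by nlinarith)]
      · simp
    simp_rw [h1]
    rw [prod_ite_eq_pow_hammingDist]
    have h2 : 2 * (1 + a * ρ)⁻¹ ≤ 2 / a * ρ⁻¹ := by
      rw [div_eq_mul_inv, mul_assoc, ← mul_inv]
      gcongr
      linarith
    calc _ ≤ (2 / a * ρ⁻¹) ^ hammingDist (codeword label G m) (codeword label G m') := by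
          gcongr
      _ ≤ _ := by
          rw [mul_pow, inv_pow]
          gcongr
          exact dmin_le_hammingDist hne.symm
  calc errorProb S label G det dec ρ
      ≤ ∫ h, (1 / (M : ℝ)) * ∑ m, ∑ _u : Fin N → F, ∑ m' with m' ≠ m, ∏ i, φ m m' i (h i)
          ∂(stdCNVec N) := by
        refine integral_mono (hdec.integrable_condErrorProb hdet hρ0) ?_
          fun h => hdec.condErrorProb_le hdet hδ hsep hρ0 h
        exact (integrable_finsetSum _ fun m _ => integrable_finsetSum _ fun _ _ =>
          integrable_finsetSum _ fun m' _ => hφ m m').const_mul _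
    _ = (1 / (M : ℝ)) * ∑ m, ∑ _u : Fin N → F, ∑ m' with m' ≠ m,
          ∫ h, ∏ i, φ m m' i (h i) ∂(stdCNVec N) := by
        rw [integral_const_mul, integral_finsetSum _ fun m _ => integrable_finsetSum _ fun _ _ =>
          integrable_finsetSum _ fun m' _ => hφ m m']
        congr 1
        refine Finset.sum_congr rfl fun m _ => ?_
        rw [integral_finsetSum _ fun _ _ => integrable_finsetSum _ fun m' _ => hφ m m']
        refine Finset.sum_congr rfl fun _ _ => ?_
        rw [integral_finsetSum _ fun m' _ => hφ m m']
    _ ≤ _ := by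
        rw [mul_assoc, Finset.sum_mul]
        gcongr with m
        rw [Finset.sum_mul]
        gcongr with u
        rw [Finset.sum_mul]
        gcongr with m' hm'
        exact hint m m' (Finset.mem_filter.1 hm').2

end CodedDiversity

end

theorem lemma1 {F : Type*} [Field F] [Fintype F] [DecidableEq F] {B K M N : ℕ}
    (hB : 1 ≤ B) (hK : 1 ≤ K) (hF : Fintype.card F = 2 ^ B)
    (S : CodedDiversity.Constellation M)
    (label : Fin M ≃ (Fin K → F)) (G : Matrix (Fin K) (Fin N) F)
    (det : ℝ → Fin N → ℂ → ℂ → Fin M) (hdet : CodedDiversity.IsHardDecision S det)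
    (dec : ℝ → (Fin N → ℂ) → (Fin N → F) → Fin M)
    (hdec : CodedDiversity.IsMLDecoder S label G det dec) :
    (∀ ρ, 0 < ρ → Integrable (CodedDiversity.condErrorProb S label G det dec ρ)
      (CodedDiversity.stdCNVec N)) ∧
    CodedDiversity.HasDiversityOrder (CodedDiversity.errorProb S label G det dec)
      (CodedDiversity.dmin label G : ℝ) := by
  have hM : 1 < M := by
    have : Nonempty (Fin K) := ⟨⟨0, hK⟩⟩
    simpa using (Fintype.one_lt_card (α := Fin K → F)).trans_eq (Fintype.card_congr label).symm
  have : Fact (1 < M) := ⟨hM⟩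
  have : NeZero M := ⟨by omega⟩
  obtain ⟨c, hc, hlow⟩ := hdec.le_errorProb hdet
  obtain ⟨C, hup⟩ := hdec.errorProb_le hdet
  exact ⟨fun ρ hρ => hdec.integrable_condErrorProb hdet hρ,
    CodedDiversity.hasDiversityOrder_of_bounds hc hlow hup⟩
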